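/- A field $K$ is called ample (or large) if every smooth curve $C$ over $K$ that has a $K$-rational point has infinitely many $K$-rational points; here a curve over $K$ is a one-dimensional variety over $K$, and varieties are geometrically irreducible and geometrically reduced. A subset $X\subseteq K$ is called existentially $K$-definable if there is an existential first-order formula $\varphi(x)$ in the language of rings, in one free variable $x$ and with parameters from $K$, such that $X$ is the set of all $a\in K$ for which $\varphi(a)$ holds in $K$. Let $K$ be a perfect ample field. Then no infinite proper subfield $F\subsetneq K$ is existentially $K$-definable. -/

import Mathlib

open CategoryTheory AlgebraicGeometry
open scoped FirstOrder

universe u v w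

/-- `f : C ⟶ Spec K` exhibits `C` as a smooth curve over the field `K`: a geometrically integral
(that is, geometrically irreducible and geometrically reduced), separated scheme of finite type
over `K` that is smooth of relative dimension `1`. Local finiteness of type is part of smoothness;
together with quasi-compactness this is finiteness of type. -/
structure IsSmoothCurve (K : Type u) [Field K] {C : Scheme.{u}} (f : C ⟶ Spec (.of K)) :
    Prop where
  isSeparated : IsSeparated f
  quasiCompact : QuasiCompact f
  geometricallyIntegral : GeometricallyIntegral f
  smooth : SmoothOfRelativeDimension 1 f

/-- The `K`-rational points of a `K`-scheme: the sections of its structure morphism. -/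
abbrev RationalPoint (K : Type u) [Field K] {C : Scheme.{u}} (f : C ⟶ Spec (.of K)) : Type u :=
  {s : Spec (.of K) ⟶ C // s ≫ f = 𝟙 (Spec (.of K))}

/-- A field `K` is ample (or large) if every smooth curve over `K` that has a `K`-rational point
has infinitely many of them. -/
def IsAmpleField (K : Type u) [Field K] : Prop :=
  ∀ (C : Scheme.{u}) (f : C ⟶ Spec (.of K)), IsSmoothCurve K f →
    Nonempty (RationalPoint K f) → Infinite (RationalPoint K f)

/-- A subset `X` of a structure `M` is existentially `A`-definable if it is the set of elements
of `M` that satisfy some existential formula in one free variable with parameters from `A`. -/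
def ExistentiallyDefinable₁ (L : FirstOrder.Language.{u, v}) {M : Type w} [L.Structure M] (A X : Set M) :
    Prop :=
  ∃ φ : L[[A]].Formula (Fin 1), φ.IsExistential ∧ X = {x : M | φ.Realize fun _ => x}

open Polynomial TensorProduct

/-! An existentially definable subfield `F` is the image, under one coordinate, of a quantifier-free
set `S` of points of affine space. If `F` is infinite, take an ideal `I` maximal among those whose
zeros in `S` have infinitely many values of that coordinate. Then `I` is prime and points of `S` are
dense in its zero set. A quantifier-free formula is constant on a nonempty open part of an
irreducible closed set, so all rational points of some open part lie in `S`: the coordinate function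
takes values in `F` there (`exists_prime_infinite_coordinate`,
`IsAmpleField.eq_top_of_infinite_subset`).

It remains to show that such a function `x` forces `F = K`. Having infinitely many values, `x` is
transcendental over `K`. In characteristic `p`, perfectness allows replacing `x` by an iterated
`p`-th root and `F` by its preimage under Frobenius, until `x` is no `p`-th power in the function
field. The function field is then formally smooth over `K[x]`, so `x` is a smooth map to the line on
an open set. Slicing through a rational point makes it étale.

The core is `IsAmpleField.eq_top_of_etale`. For `c ∉ F` and a point with coordinate `a`, form the
fibre product of the étale cover with its twist by the substitution `X ↦ a + c (X - a)`. This is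
again étale over the line and has a rational point over `a`, so ampleness gives infinitely many
common values. If all coordinates were in `F`, then `c` would be a quotient of elements of `F`
unless the common value is `a`. -/

/-! ### Geometric integrality near a rational point of an étale cover of the line -/

/-- A ring that is separated for the `t`-adic filtration, where `t` is a non-zero-divisor generating
a prime ideal, is a domain. -/
theorem isDomain_of_separated {R : Type*} [CommRing R] (t : R) (ht : ∀ x, t * x = 0 → x = 0)
    (hp : (Ideal.span {t}).IsPrime) (hsep : ∀ x, (∀ n : ℕ, t ^ n ∣ x) → x = 0) : IsDomain R := by
  have hfac : ∀ x : R, x ≠ 0 → ∃ (n : ℕ) (y : R), x = t ^ n * y ∧ ¬ t ∣ y := by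
    intro x hx
    have : ∃ n : ℕ, ¬ t ^ n ∣ x := by
      by_contra! h
      exact hx (hsep x h)
    classical
    have hn := Nat.find_spec this
    have hpos : Nat.find this ≠ 0 := by
      intro h0
      rw [h0] at hn
      simp at hn
    obtain ⟨k, hk⟩ := Nat.exists_eq_succ_of_ne_zero hpos
    have hk' : t ^ k ∣ x := by
      by_contra h
      exact absurd (Nat.find_min' this h) (by omega)
    obtain ⟨y, rfl⟩ := hk'
    refine ⟨k, y, rfl, fun ⟨z, hz⟩ ↦ hn ?_⟩
    rw [hk, hz, pow_succ]
    exact ⟨z, by ring⟩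
  have htpow : ∀ (n : ℕ) (x : R), t ^ n * x = 0 → x = 0 := by
    intro n
    induction n with
    | zero => intro x hx; simpa using hx
    | succ n ih =>
      intro x hx
      exact ih x (ht _ (by rw [← hx]; ring))
  have hnt : Nontrivial R := by
    by_contra h
    rw [not_nontrivial_iff_subsingleton] at h
    exact hp.ne_top (Subsingleton.elim _ _)
  have : NoZeroDivisors R := by
    refine ⟨fun {a b} hab ↦ ?_⟩
    by_contra! h
    obtain ⟨m, y, rfl, hy⟩ := hfac a h.1
    obtain ⟨n, z, rfl, hz⟩ := hfac b h.2
    have h0 : y * z = 0 := htpow (m + n) _ (by rw [← hab]; ring)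
    rcases hp.mem_or_mem (x := y) (y := z) (by rw [h0]; exact zero_mem _) with h1 | h1
    · exact hy (Ideal.mem_span_singleton.mp h1)
    · exact hz (Ideal.mem_span_singleton.mp h1)
  exact NoZeroDivisors.to_isDomain R

/-- Let `R` be a `K`-algebra that is separated for the `t`-adic filtration, where `t` is a
non-zero-divisor with `R / tR = K`. Then `R ⊗ L` is a domain for all field extensions `L / K`. -/
theorem isDomain_tensorProduct_of_separated {K R L : Type*} [Field K] [CommRing R] [Algebra K R]
    [Field L] [Algebra K L] (t : R) (ht : ∀ x, t * x = 0 → x = 0)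
    (P : R →ₐ[K] K) (hP : RingHom.ker P = Ideal.span {t})
    (hsep : ∀ x, (∀ n : ℕ, t ^ n ∣ x) → x = 0) : IsDomain (R ⊗[K] L) := by
  -- `R ⊗ L` is free over `R`, so regularity of `t` and separatedness can be checked on coordinates.
  let b := (Module.Basis.ofVectorSpace K L).baseChange R
  have hmul : ∀ (r : R) (x : R ⊗[K] L), (r ⊗ₜ[K] (1 : L)) * x = r • x := by
    intro r x
    rw [Algebra.smul_def, Algebra.TensorProduct.algebraMap_apply]
    rfl
  refine isDomain_of_separated (t ⊗ₜ[K] (1 : L)) (fun x hx ↦ ?_) ?_ (fun x hx ↦ ?_)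
  · rw [hmul] at hx
    apply b.repr.injective
    ext i
    apply ht
    simpa using congr(b.repr $hx i)
  · let Q : R ⊗[K] L →ₐ[K] L := Algebra.TensorProduct.lift ((Algebra.ofId K L).comp P) (AlgHom.id K L)
      (fun _ _ ↦ .all _ _)
    have hQ : Ideal.span {t ⊗ₜ[K] (1 : L)} = RingHom.ker Q := by
      apply le_antisymm
      · rw [Ideal.span_singleton_le_iff_mem, RingHom.mem_ker]
        have : P t = 0 := by
          have : t ∈ RingHom.ker P := by rw [hP]; exact Ideal.mem_span_singleton_self t
          exact this
        simp [Q, this]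
      · intro x hx
        have key : ∀ x : R ⊗[K] L, x - (1 : R) ⊗ₜ[K] Q x ∈ Ideal.span {t ⊗ₜ[K] (1 : L)} := by
          intro x
          induction x with
          | zero => simp
          | add x y hx hy =>
            rw [map_add, TensorProduct.tmul_add, add_sub_add_comm]
            exact add_mem hx hy
          | tmul r l =>
            have h1 : r - algebraMap K R (P r) ∈ Ideal.span {t} := by
              rw [← hP, RingHom.mem_ker]
              simp
            obtain ⟨s, hs⟩ := Ideal.mem_span_singleton.mp h1
            have h2 : r ⊗ₜ[K] l - (1 : R) ⊗ₜ[K] Q (r ⊗ₜ l) = (t ⊗ₜ[K] (1 : L)) * (s ⊗ₜ l) := by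
              have h3 : Q (r ⊗ₜ l) = P r • l := by
                simp [Q, Algebra.smul_def, Algebra.ofId_apply]
              rw [h3, ← TensorProduct.smul_tmul, ← TensorProduct.sub_tmul, Algebra.smul_def,
                mul_one, hs]
              simp
            rw [h2]
            exact Ideal.mul_mem_right _ _ (Ideal.mem_span_singleton_self _)
        have := key x
        rw [RingHom.mem_ker] at hx
        rw [hx] at this
        simpa using this
    rw [hQ]
    exact RingHom.ker_isPrime _
  · apply b.repr.injective
    ext i
    simp only [map_zero, Finsupp.coe_zero, Pi.zero_apply]
    apply hsep
    intro n
    obtain ⟨y, rfl⟩ := hx n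
    rw [Algebra.TensorProduct.tmul_pow, one_pow, hmul, map_smul]
    exact ⟨b.repr y i, rfl⟩

/-- The fibres of a scheme étale over the affine line have finitely many rational points. -/
theorem finite_algHom_fiber {K A : Type*} [Field K] [CommRing A]
    [Algebra K A] [Algebra K[X] A] [IsScalarTower K K[X] A] [Algebra.Etale K[X] A] (x : K) :
    {Q : A →ₐ[K] K | Q (algebraMap K[X] A X) = x}.Finite := by
  let : Algebra K[X] K := (Polynomial.aeval x).toAlgebra
  have hX : algebraMap K[X] K X = x := by
    simp [RingHom.algebraMap_toAlgebra]
  have : IsScalarTower K K[X] K := .of_algebraMap_eq' (by ext; simp [RingHom.algebraMap_toAlgebra])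
  have : Module.Finite K (K ⊗[K[X]] A) := Algebra.FormallyUnramified.finite_of_free K _
  have hcomm : ∀ Q : A →ₐ[K] K, Q (algebraMap K[X] A X) = x →
      ∀ p, Q (algebraMap K[X] A p) = algebraMap K[X] K p := by
    intro Q hQ p
    have : Q.comp (IsScalarTower.toAlgHom K K[X] A) = IsScalarTower.toAlgHom K K[X] K :=
      Polynomial.algHom_ext (by simpa [hX] using hQ)
    exact congr($this p)
  let e : {Q : A →ₐ[K] K | Q (algebraMap K[X] A X) = x} → (K ⊗[K[X]] A →ₐ[K] K) := fun Q ↦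
    Algebra.TensorProduct.lift (AlgHom.id K K)
      ({ __ := Q.1, commutes' := hcomm Q.1 Q.2 } : A →ₐ[K[X]] K) (fun _ _ ↦ .all _ _)
  have he : Function.Injective e := by
    rintro ⟨Q, hQ⟩ ⟨Q', hQ'⟩ h
    ext a
    simpa [e] using congr($h (1 ⊗ₜ a))
  have := Finite.of_injective e he
  exact Set.toFinite _

-- Unramifiedness makes the maximal ideal of the image point on the line generate the one upstairs,
-- so `X - a` is a uniformizer.
open IsLocalRing in
theorem maximalIdeal_localization_of_etale {K A : Type*} [Field K] [CommRing A]
    [Algebra K A] [Algebra K[X] A] [IsScalarTower K K[X] A] [Algebra.Etale K[X] A] (P : A →ₐ[K] K) [(RingHom.ker P).IsPrime] :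
    maximalIdeal (Localization.AtPrime (RingHom.ker P)) =
      Ideal.span {algebraMap K[X] (Localization.AtPrime (RingHom.ker P))
        (X - C (P (algebraMap K[X] A X)))} := by
  set a := P (algebraMap K[X] A X)
  have hcomp : P.comp (IsScalarTower.toAlgHom K K[X] A) = Polynomial.aeval a :=
    Polynomial.algHom_ext (by simp [a])
  have hp : (RingHom.ker P).under K[X] = Ideal.span {X - C a} := by
    rw [← Polynomial.ker_evalRingHom]
    ext p
    have := congr($hcomp p)
    simp at this
    simp [Ideal.under, Ideal.mem_comap, RingHom.mem_ker, this]
  let := Localization.AtPrime.algebraOfLiesOver ((RingHom.ker P).under K[X]) (RingHom.ker P)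
  have : Algebra.IsUnramifiedAt K[X] (RingHom.ker P) :=
    Algebra.FormallyUnramified.comp _ A _
  have h := ((Algebra.isUnramifiedAt_iff_map_eq K[X] ((RingHom.ker P).under K[X])
    (RingHom.ker P)).mp inferInstance).2
  rw [← h, hp, Ideal.map_span, Set.image_singleton]

/-- The uniformizer `X - a` is regular by flatness over `K[X]`, its quotient is `K` because the
point is rational, and Krull's intersection theorem gives separatedness. -/
theorem isDomain_localization_tensorProduct_of_etale {K A L : Type*} [Field K]
    [CommRing A] [Algebra K A] [Algebra K[X] A] [IsScalarTower K K[X] A] [Algebra.Etale K[X] A] (P : A →ₐ[K] K) [(RingHom.ker P).IsPrime]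
    [Field L] [Algebra K L] : IsDomain (Localization.AtPrime (RingHom.ker P) ⊗[K] L) := by
  set R := Localization.AtPrime (RingHom.ker P)
  have hN : IsNoetherianRing A := Algebra.FiniteType.isNoetherianRing K[X] A
  have : IsNoetherianRing R := IsLocalization.isNoetherianRing (RingHom.ker P).primeCompl _ hN
  have hmax := maximalIdeal_localization_of_etale P
  set t := algebraMap K[X] R (X - C (P (algebraMap K[X] A X))) with ht
  let P' : R →ₐ[K] K := IsLocalization.liftAlgHom (M := (RingHom.ker P).primeCompl) (f := P)
    (fun y ↦ IsUnit.mk0 _ y.2)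
  have hflat : Module.Flat K[X] R := by
    have : Module.Flat A R := IsLocalization.flat R (RingHom.ker P).primeCompl
    exact .trans K[X] A R
  refine isDomain_tensorProduct_of_separated t (fun x hx ↦ ?_) P' ?_ (fun x hx ↦ ?_)
  · have hreg : IsSMulRegular R t :=
      ((IsRegular.of_ne_zero (X_sub_C_ne_zero _)).left.isSMulRegular).of_flat
    apply hreg
    simpa using hx
  · rw [← hmax]
    exact IsLocalRing.eq_maximalIdeal (RingHom.ker_isMaximal_of_surjective _ fun x ↦
      ⟨algebraMap K R x, P'.commutes x⟩)
  · have := Ideal.iInf_pow_eq_bot_of_isLocalRing (Ideal.span {t})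
      (by rw [← hmax]; exact Ideal.IsPrime.ne_top')
    rw [← Ideal.mem_bot, ← this, Ideal.mem_iInf]
    intro n
    rw [Ideal.span_singleton_pow, Ideal.mem_span_singleton]
    exact hx n

/-- The kernel of `A → A_p` is finitely generated and each generator is killed by some element
outside `p`; take `f` to be the product. This spreads integrality from the local ring to a
neighbourhood. -/
theorem exists_away_injective_localization {A : Type*} [CommRing A] [IsNoetherianRing A]
    (p : Ideal A) [p.IsPrime] :
    ∃ f ∉ p, ∀ (Af : Type _) [CommRing Af] [Algebra A Af] [IsLocalization.Away f Af]
      (g : Af →ₐ[A] Localization.AtPrime p), Function.Injective g := by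
  obtain ⟨s, hs⟩ := (inferInstance : IsNoetherianRing A).noetherian
    (RingHom.ker (algebraMap A (Localization.AtPrime p)))
  have h : ∀ x : s, ∃ f ∉ p, f * x = 0 := by
    intro x
    have : x.1 ∈ RingHom.ker (algebraMap A (Localization.AtPrime p)) := by
      rw [← hs]; exact Ideal.subset_span x.2
    obtain ⟨c, hc⟩ := (IsLocalization.map_eq_zero_iff p.primeCompl _ _).mp this
    exact ⟨c, c.2, hc⟩
  choose f hf hfx using h
  have hker : ∀ x ∈ RingHom.ker (algebraMap A (Localization.AtPrime p)), (∏ i, f i) * x = 0 := by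
    intro x hx
    rw [← hs] at hx
    induction hx using Submodule.span_induction with
    | mem x hx =>
      obtain ⟨c, hc⟩ := Finset.dvd_prod_of_mem f (Finset.mem_univ ⟨x, hx⟩)
      rw [hc, mul_right_comm, hfx, zero_mul]
    | zero => simp
    | add x y _ _ hx hy => rw [mul_add, hx, hy, add_zero]
    | smul a x _ hx => rw [smul_eq_mul, mul_left_comm, hx, mul_zero]
  refine ⟨∏ i, f i, fun hmem ↦ ?_, fun Af _ _ _ g ↦ ?_⟩
  · obtain ⟨i, -, hi⟩ := (Ideal.IsPrime.prod_mem_iff (p := p)).mp hmem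
    exact hf i hi
  · rw [injective_iff_map_eq_zero]
    intro x hx
    obtain ⟨⟨a, s⟩, has⟩ := IsLocalization.surj (Submonoid.powers (∏ i, f i)) x
    have h1 : algebraMap A (Localization.AtPrime p) a = 0 := by
      rw [← g.commutes, ← has, map_mul, hx, zero_mul]
    have h2 : algebraMap A Af a = 0 :=
      (IsLocalization.map_eq_zero_iff (Submonoid.powers (∏ i, f i)) _ _).mpr
        ⟨⟨_, Submonoid.mem_powers _⟩, hker _ h1⟩
    have h3 := IsLocalization.map_units Af s
    rw [h2] at has
    exact (h3.mul_left_eq_zero).mp has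

theorem isStandardSmoothOfRelativeDimension_one_polynomial (K : Type*) [Field K] :
    Algebra.IsStandardSmoothOfRelativeDimension 1 K K[X] := by
  let b : Module.Basis Unit K[X] (Ω[K[X]⁄K]) :=
    (Module.Basis.singleton Unit K[X]).map (KaehlerDifferential.polynomialEquiv K).symm
  have : Algebra.IsStandardSmooth K K[X] := by
    refine .of_basis_kaehlerDifferential b ?_
    rintro _ ⟨i, rfl⟩
    exact ⟨X, by simp [b]⟩
  rw [Algebra.IsStandardSmoothOfRelativeDimension.iff_of_isStandardSmooth, rank_eq_card_basis b]
  simp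

/-! ### Ampleness and étale covers of the line -/

/-- An affine scheme étale over the affine line that is geometrically integral is a smooth curve. -/
theorem isSmoothCurve_of_etale {K A : Type u} [Field K] [CommRing A] [Algebra K A]
    [Algebra K[X] A] [IsScalarTower K K[X] A] [Algebra.Etale K[X] A]
    (hdom : ∀ (L : Type u) [Field L] [Algebra K L], IsDomain (A ⊗[K] L)) :
    IsSmoothCurve K (Spec.map (CommRingCat.ofHom (algebraMap K A))) where
  isSeparated := inferInstance
  quasiCompact := inferInstance
  geometricallyIntegral := by
    rw [geometricallyIntegral_iff, geometrically_iff_of_commRing]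
    intro L _ _ Y fst snd h
    have := hdom L
    have : IsIntegral (Spec (CommRingCat.of (A ⊗[K] L))) := inferInstance
    let e : Y ≅ Spec (CommRingCat.of (A ⊗[K] L)) := h.isoPullback ≪≫ pullbackSpecIso K A L
    have : Nonempty Y := ⟨e.inv (Classical.arbitrary (Spec (CommRingCat.of (A ⊗[K] L))))⟩
    exact isIntegral_of_isOpenImmersion e.hom
  smooth := by
    have := isStandardSmoothOfRelativeDimension_one_polynomial K
    have : Algebra.IsStandardSmoothOfRelativeDimension 0 K[X] A :=
      Algebra.Etale.iff_isStandardSmoothOfRelativeDimension_zero.mp inferInstance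
    have h : Algebra.IsStandardSmoothOfRelativeDimension (0 + 1) K A :=
      .trans _ _ K K[X] A
    rw [HasRingHomProperty.Spec_iff (P := @SmoothOfRelativeDimension 1)]
    refine RingHom.locally_of RingHom.isStandardSmoothOfRelativeDimension_respectsIso _ ?_
    simpa [RingHom.isStandardSmoothOfRelativeDimension_algebraMap] using h

/-- The rational points of `Spec A` are the `K`-algebra homomorphisms `A → K`. -/
noncomputable def rationalPointEquiv (K A : Type u) [Field K] [CommRing A] [Algebra K A] :
    RationalPoint K (Spec.map (CommRingCat.ofHom (algebraMap K A))) ≃ (A →ₐ[K] K) where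
  toFun s := { (Spec.preimage s.1).hom with
    commutes' := fun r ↦ by
      have h : CommRingCat.ofHom (algebraMap K A) ≫ Spec.preimage s.1 = 𝟙 _ := by
        apply Spec.map_injective
        rw [Spec.map_comp, Spec.map_preimage, s.2, Spec.map_id]
      exact congr($h r) }
  invFun Q := ⟨Spec.map (CommRingCat.ofHom Q.toRingHom), by
    rw [← Spec.map_comp, ← CommRingCat.ofHom_comp]
    have : Q.toRingHom.comp (algebraMap K A) = RingHom.id K := by ext; simp
    rw [this]
    exact Spec.map_id _⟩
  left_inv s := by
    ext1
    exact Spec.map_preimage s.1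
  right_inv Q := by
    ext a
    change (Spec.preimage (Spec.map (CommRingCat.ofHom Q.toRingHom))).hom a = Q a
    rw [Spec.preimage_map]
    rfl

/-- Over an ample field, a scheme étale over the affine line with one rational point has infinitely
many rational points. -/
theorem IsAmpleField.infinite_algHom {K A : Type u} [Field K] (hK : IsAmpleField K) [CommRing A]
    [Algebra K A] [Algebra K[X] A] [IsScalarTower K K[X] A] [Algebra.Etale K[X] A]
    (P : A →ₐ[K] K) : Infinite (A →ₐ[K] K) := by
  have hprime : (RingHom.ker P).IsPrime := RingHom.ker_isPrime _
  have hN : IsNoetherianRing A := Algebra.FiniteType.isNoetherianRing K[X] A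
  obtain ⟨f, hf, hinj⟩ := exists_away_injective_localization (RingHom.ker P)
  let R := Localization.AtPrime (RingHom.ker P)
  let Af := Localization.Away f
  let g : Af →ₐ[A] R := IsLocalization.liftAlgHom (M := Submonoid.powers f) (f := Algebra.ofId A R) (by
    rintro ⟨_, n, rfl⟩
    rw [map_pow]
    exact (IsLocalization.map_units R (⟨f, hf⟩ : (RingHom.ker P).primeCompl)).pow n)
  have hg : Function.Injective g := hinj Af g
  have : Algebra.Etale A Af := .of_isLocalizationAway f
  have : Algebra.Etale K[X] Af := .comp K[X] A Af
  have hcurve := isSmoothCurve_of_etale (K := K) (A := Af) (fun L _ _ ↦ by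
    have := isDomain_localization_tensorProduct_of_etale (L := L) P
    -- Flatness over `K` embeds `Af ⊗ L` into the domain `R ⊗ L`.
    have hinj : Function.Injective (Algebra.TensorProduct.map (g.restrictScalars K) (AlgHom.id K L)) :=
      Module.Flat.rTensor_preserves_injective_linearMap (g.restrictScalars K).toLinearMap hg
    exact hinj.isDomain (Algebra.TensorProduct.map (g.restrictScalars K) (AlgHom.id K L)).toRingHom)
  let Pf : Af →ₐ[K] K := IsLocalization.liftAlgHom (M := Submonoid.powers f) (f := P) (by
    rintro ⟨_, n, rfl⟩
    rw [map_pow]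
    exact (IsUnit.mk0 _ hf).pow n)
  have hinf := hK _ _ hcurve ⟨(rationalPointEquiv K Af).symm Pf⟩
  have : Infinite (Af →ₐ[K] K) := (rationalPointEquiv K Af).infinite_iff.mp hinf
  refine Infinite.of_injective (fun Q : Af →ₐ[K] K ↦ Q.comp (IsScalarTower.toAlgHom K A Af)) ?_
  intro Q Q' h
  apply AlgHom.coe_ringHom_injective
  apply IsLocalization.ringHom_ext (Submonoid.powers f)
  ext a
  exact congr($h a)

theorem IsAmpleField.infinite_values {K A : Type u} [Field K] (hK : IsAmpleField K) [CommRing A]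
    [Algebra K A] [Algebra K[X] A] [IsScalarTower K K[X] A] [Algebra.Etale K[X] A]
    (P : A →ₐ[K] K) : (Set.range fun Q : A →ₐ[K] K ↦ Q (algebraMap K[X] A X)).Infinite := by
  intro hfin
  have := hK.infinite_algHom P
  refine Set.infinite_univ (α := A →ₐ[K] K) ((hfin.biUnion fun x _ ↦
    finite_algHom_fiber (K := K) (A := A) x).subset fun Q _ ↦ ?_)
  exact Set.mem_biUnion (Set.mem_range_self Q) rfl

/-- Points of the fibre product over the line are pairs with equal coordinate; it is étale over the
line, and the two given points combine to a point of it. -/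
theorem IsAmpleField.infinite_common_values {K A B : Type u} [Field K] (hK : IsAmpleField K)
    [CommRing A] [Algebra K A] [Algebra K[X] A] [IsScalarTower K K[X] A] [Algebra.Etale K[X] A]
    [CommRing B] [Algebra K B] [Algebra K[X] B] [IsScalarTower K K[X] B] [Algebra.Etale K[X] B]
    (P : A →ₐ[K] K) (P' : B →ₐ[K] K) (h : P (algebraMap K[X] A X) = P' (algebraMap K[X] B X)) :
    {x : K | ∃ (Q : A →ₐ[K] K) (Q' : B →ₐ[K] K), Q (algebraMap K[X] A X) = x ∧
      Q' (algebraMap K[X] B X) = x}.Infinite := by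
  have : Algebra.Etale K[X] (A ⊗[K[X]] B) := .comp K[X] A _
  let : Algebra K[X] K := (Polynomial.aeval (P (algebraMap K[X] A X))).toAlgebra
  have hX : algebraMap K[X] K X = P (algebraMap K[X] A X) := by
    simp [RingHom.algebraMap_toAlgebra]
  have : IsScalarTower K K[X] K := .of_algebraMap_eq' (by ext; simp [RingHom.algebraMap_toAlgebra])
  have h1 : P.comp (IsScalarTower.toAlgHom K K[X] A) = IsScalarTower.toAlgHom K K[X] K :=
    Polynomial.algHom_ext (by simp [hX])
  have h2 : P'.comp (IsScalarTower.toAlgHom K K[X] B) = IsScalarTower.toAlgHom K K[X] K :=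
    Polynomial.algHom_ext (by simp [hX, h])
  let P₁ : A →ₐ[K[X]] K := { __ := P, commutes' := fun p ↦ congr($h1 p) }
  let P₂ : B →ₐ[K[X]] K := { __ := P', commutes' := fun p ↦ congr($h2 p) }
  let PP : A ⊗[K[X]] B →ₐ[K] K :=
    (Algebra.TensorProduct.lift P₁ P₂ (fun _ _ ↦ .all _ _)).restrictScalars K
  refine (hK.infinite_values PP).mono ?_
  rintro _ ⟨Q, rfl⟩
  refine ⟨Q.comp ((Algebra.TensorProduct.includeLeft : A →ₐ[K[X]] A ⊗[K[X]] B).restrictScalars K),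
    Q.comp ((Algebra.TensorProduct.includeRight : B →ₐ[K[X]] A ⊗[K[X]] B).restrictScalars K),
    ?_, ?_⟩
  · simp
  · simp

/-- The coordinates of the rational points of a scheme étale over the affine line do not all lie in
a proper subfield: otherwise, for `c` outside it, `Q(X) - a = c (Q'(X) - a)` would force `Q(X) = a`. -/
theorem IsAmpleField.eq_top_of_etale {K A : Type u} [Field K] (hK : IsAmpleField K)
    [CommRing A] [Algebra K A] [Algebra K[X] A] [IsScalarTower K K[X] A] [Algebra.Etale K[X] A]
    (P : A →ₐ[K] K) (F : Subfield K) (hF : ∀ Q : A →ₐ[K] K, Q (algebraMap K[X] A X) ∈ F) :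
    F = ⊤ := by
  by_contra hne
  obtain ⟨c, hc⟩ : ∃ c, c ∉ F := by
    by_contra! h
    exact hne (eq_top_iff.mpr fun x _ ↦ h x)
  have hc0 : c ≠ 0 := fun h ↦ hc (h ▸ zero_mem F)
  set a := P (algebraMap K[X] A X) with ha
  -- The affine substitution with fixed point `a` and slope `c`. As an automorphism of the line it
  -- keeps the twisted structure `τ` étale, and `P` lies over `a` for both structures.
  let σ : K[X] ≃ₐ[K] K[X] := AlgEquiv.ofAlgHom
    (aeval (C a + C c * (X - C a))) (aeval (C a + C c⁻¹ * (X - C a)))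
    (by
      ext
      simp only [AlgHom.comp_apply, aeval_X, map_add, map_mul, map_sub, AlgHom.id_apply,
        aeval_C, algebraMap_eq]
      rw [add_sub_cancel_left, ← mul_assoc, ← C_mul, inv_mul_cancel₀ hc0]
      simp)
    (by
      ext
      simp only [AlgHom.comp_apply, aeval_X, map_add, map_mul, map_sub, AlgHom.id_apply,
        aeval_C, algebraMap_eq]
      rw [add_sub_cancel_left, ← mul_assoc, ← C_mul, mul_inv_cancel₀ hc0]
      simp)
  let τ : K[X] →+* A := (algebraMap K[X] A).comp σ.toRingEquiv.toRingHom
  have hτ : τ.Etale := RingHom.Etale.stableUnderComposition _ _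
    (RingHom.Etale.of_bijective σ.bijective) (RingHom.etale_algebraMap.mpr inferInstance)
  have hτX : τ X = algebraMap K A a + algebraMap K A c * (algebraMap K[X] A X - algebraMap K A a) := by
    have : σ X = C a + C c * (X - C a) := by simp [σ]
    change algebraMap K[X] A (σ X) = _
    rw [this]
    simp only [map_add, map_mul, map_sub, IsScalarTower.algebraMap_apply K K[X] A, algebraMap_eq]
  have hτC : ∀ x, algebraMap K A x = τ (algebraMap K K[X] x) := by
    intro x
    change _ = algebraMap K[X] A (σ (algebraMap K K[X] x))
    rw [AlgEquiv.commutes, ← IsScalarTower.algebraMap_apply]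
  have key := @IsAmpleField.infinite_common_values K A A _ hK _ _ _ _ _ _ _ τ.toAlgebra
    (@IsScalarTower.of_algebraMap_eq K K[X] A _ _ _ _ τ.toAlgebra _ hτC) hτ P P
    (by
      change _ = P (τ X)
      rw [hτX]
      simp [← ha])
  refine key ((Set.finite_singleton a).subset ?_)
  rintro x ⟨Q, Q', hQ, hQ'⟩
  have h1 : Q' (τ X) = x := hQ'
  rw [hτX] at h1
  simp only [map_add, map_mul, map_sub, AlgHom.commutes, Algebra.algebraMap_self, RingHom.id_apply] at h1
  have haF : a ∈ F := hF P
  have hxF : x ∈ F := hQ ▸ hF Q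
  have hyF := hF Q'
  set y := Q' (algebraMap K[X] A X)
  have : y = a := by
    by_contra hy
    apply hc
    have : c = (x - a) / (y - a) := by
      rw [eq_div_iff (sub_ne_zero.mpr hy), ← h1]
      ring
    rw [this]
    exact F.div_mem (F.sub_mem hxF haF) (F.sub_mem hyF haF)
  rw [Set.mem_singleton_iff, ← h1, this]
  ring

/-! ### Slicing smooth maps to étale ones -/

/-- Phrased with ring homomorphisms so that `T` needs no prior `M`-algebra structure. -/
theorem exists_ringHom_tensorProduct {M S D T : Type*} [CommRing M] [CommRing S] [CommRing D]
    [CommRing T] [Algebra M S] [Algebra M D] (f : S →+* T) (g : D →+* T)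
    (h : f.comp (algebraMap M S) = g.comp (algebraMap M D)) :
    ∃ k : S ⊗[M] D →+* T, ∀ s, k (s ⊗ₜ 1) = f s := by
  let : Algebra M T := (g.comp (algebraMap M D)).toAlgebra
  let f' : S →ₐ[M] T := { f with commutes' := fun m ↦ congr($h m) }
  let g' : D →ₐ[M] T := { g with commutes' := fun m ↦ rfl }
  refine ⟨(Algebra.TensorProduct.lift f' g' (fun _ _ ↦ .all _ _)).toRingHom, fun s ↦ ?_⟩
  simp [f']

/-- Pulling `D` back along the section `ρ` gives `K[X] ⊗[M] D`, étale over the line. By `hρ` the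
point `P` lies on this slice, and points of the slice are points of `D` with the same coordinate. -/
theorem IsAmpleField.eq_top_of_etale_of_section {K D : Type u} [Field K] (hK : IsAmpleField K)
    {M : Type*} [CommRing M] [Algebra K M] [Algebra K[X] M] [IsScalarTower K K[X] M]
    [CommRing D] [Algebra K D] [Algebra K[X] D] [Algebra M D]
    [IsScalarTower K K[X] D] [IsScalarTower K[X] M D] [Algebra.Etale M D]
    (P : D →ₐ[K] K) (ρ : M →ₐ[K[X]] K[X])
    (hρ : ∀ m, P (algebraMap M D m) = eval (P (algebraMap K[X] D X)) (ρ m))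
    (F : Subfield K) (hF : ∀ Q : D →ₐ[K] K, Q (algebraMap K[X] D X) ∈ F) :
    F = ⊤ := by
  let : Algebra M K[X] := ρ.toRingHom.toAlgebra
  have : IsScalarTower K[X] M K[X] := .of_algebraMap_eq' ρ.comp_algebraMap.symm
  have : IsScalarTower K M K[X] := .of_algebraMap_eq' (by
    rw [IsScalarTower.algebraMap_eq K K[X] M, ← RingHom.comp_assoc,
      ← IsScalarTower.algebraMap_eq K[X] M K[X]]
    rfl)
  have : IsScalarTower K M D := .of_algebraMap_eq' (by
    rw [IsScalarTower.algebraMap_eq K K[X] M, ← RingHom.comp_assoc,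
      ← IsScalarTower.algebraMap_eq K[X] M D, ← IsScalarTower.algebraMap_eq])
  obtain ⟨PP, hPP⟩ := exists_ringHom_tensorProduct (M := M)
    (aeval (P (algebraMap K[X] D X)) : K[X] →ₐ[K] K).toRingHom P.toRingHom (by
      ext m
      change aeval _ (ρ m) = P (algebraMap M D m)
      rw [hρ, coe_aeval_eq_eval])
  let PP : K[X] ⊗[M] D →ₐ[K] K :=
    { PP with
      commutes' := fun x ↦ (hPP (algebraMap K K[X] x)).trans (by simp) }
  refine hK.eq_top_of_etale (A := K[X] ⊗[M] D) PP F fun Q ↦ ?_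
  let j : D →ₐ[K] K[X] ⊗[M] D :=
    (Algebra.TensorProduct.includeRight : D →ₐ[M] K[X] ⊗[M] D).restrictScalars K
  have h := hF (Q.comp j)
  have hX : j (algebraMap K[X] D X) = algebraMap K[X] (K[X] ⊗[M] D) X := by
    rw [IsScalarTower.algebraMap_apply K[X] M D]
    change (Algebra.TensorProduct.includeRight : D →ₐ[M] K[X] ⊗[M] D) _ = _
    rw [AlgHom.commutes, Algebra.TensorProduct.algebraMap_apply,
      ← IsScalarTower.algebraMap_apply K[X] M K[X]]
    rfl
  rwa [AlgHom.comp_apply, hX] at h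

/-- The values of a function that is smooth as a map to the affine line do not all lie in a proper
subfield. -/
theorem IsAmpleField.eq_top_of_smooth {K D : Type u} [Field K] (hK : IsAmpleField K)
    [CommRing D] [Algebra K D] [Algebra K[X] D] [IsScalarTower K K[X] D] [Algebra.Smooth K[X] D]
    (P : D →ₐ[K] K) (F : Subfield K) (hF : ∀ Q : D →ₐ[K] K, Q (algebraMap K[X] D X) ∈ F) :
    F = ⊤ := by
  have hprime : (RingHom.ker P).IsPrime := RingHom.ker_isPrime _
  have : Algebra.IsSmoothAt K[X] (RingHom.ker P) := by
    have : Algebra.FormallySmooth D (Localization.AtPrime (RingHom.ker P)) :=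
      .of_isLocalization (RingHom.ker P).primeCompl
    exact Algebra.FormallySmooth.comp K[X] D _
  obtain ⟨f, hf, n, _, _, hstd⟩ := Algebra.IsSmoothAt.exists_isStandardEtale_mvPolynomial (R := K[X])
    (p := RingHom.ker P)
  let Pf : Localization.Away f →ₐ[K] K :=
    IsLocalization.liftAlgHom (M := Submonoid.powers f) (f := P) (by
      rintro ⟨_, m, rfl⟩
      rw [map_pow]
      exact (IsUnit.mk0 _ hf).pow m)
  -- The slice freezes the `n` fibre coordinates at their values at `Pf`.
  let ρ : MvPolynomial (Fin n) K[X] →ₐ[K[X]] K[X] := MvPolynomial.aeval fun i ↦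
    C (Pf (algebraMap (MvPolynomial (Fin n) K[X]) (Localization.Away f) (.X i)))
  have hρ : Pf.toRingHom.comp (algebraMap (MvPolynomial (Fin n) K[X]) (Localization.Away f)) =
      (evalRingHom (Pf (algebraMap K[X] (Localization.Away f) X))).comp ρ.toRingHom := by
    have hC (p : K[X]) : algebraMap (MvPolynomial (Fin n) K[X]) (Localization.Away f)
        (MvPolynomial.C p) = algebraMap K[X] (Localization.Away f) p :=
      (IsScalarTower.algebraMap_apply K[X] (MvPolynomial (Fin n) K[X]) (Localization.Away f) p).symm
    apply MvPolynomial.ringHom_ext'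
    · apply Polynomial.ringHom_ext
      · intro x
        have : algebraMap K[X] (Localization.Away f) (C x) = algebraMap K _ x :=
          (IsScalarTower.algebraMap_apply K K[X] _ x).symm
        simp [ρ, hC, this]
      · simp [ρ, hC]
    · intro i
      simp [ρ]
  refine hK.eq_top_of_etale_of_section Pf ρ (fun m ↦ congr($hρ m)) F fun Q ↦ ?_
  simpa [← IsScalarTower.algebraMap_apply] using
    hF (Q.comp (IsScalarTower.toAlgHom K D (Localization.Away f)))

/-! ### Formal smoothness of function fields and `p`-th roots -/

/-- If `x` is not a `p`-th power in `E`, then `1, x, …, x ^ (p - 1)` are linearly independent over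
`E ^ p`. -/
theorem eq_zero_of_sum_pow_mul_pow_eq_zero {E : Type*} [Field E] (p : ℕ) [Fact p.Prime] [CharP E p]
    {x : E} (hx : ∀ y, y ^ p ≠ x) (y : Fin p → E) (h : ∑ j, y j ^ p * x ^ (j : ℕ) = 0) (j : Fin p) :
    y j = 0 := by
  have hp : p.Prime := Fact.out
  let M := (frobenius E p).fieldRange
  let a : M := ⟨x ^ p, x, rfl⟩
  have hirr : Irreducible (X ^ p - C a) := by
    apply X_pow_sub_C_irreducible_of_prime hp
    rintro ⟨_, b, rfl⟩ hb
    refine hx b (frobenius_inj E p ?_)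
    have := congr_arg Subtype.val hb
    simpa [a, frobenius_def] using this
  let c : Fin p → M := fun j ↦ ⟨y j ^ p, y j, frobenius_def ..⟩
  let q : M[X] := ∑ j : Fin p, C (c j) * X ^ (j : ℕ)
  have hqx : aeval x q = 0 := by
    rw [← h]
    simp only [q, map_sum, map_mul, aeval_C, map_pow, aeval_X]
    rfl
  have hmin : minpoly M x = X ^ p - C a := by
    refine (minpoly.eq_of_irreducible_of_monic hirr ?_ (monic_X_pow_sub_C a hp.ne_zero)).symm
    simp only [map_sub, map_pow, aeval_X, aeval_C]
    exact sub_self _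
  have hdeg : q.degree < p := by
    refine (degree_sum_le _ _).trans_lt ((Finset.sup_lt_iff (WithBot.bot_lt_coe p)).mpr ?_)
    intro i _
    exact (degree_C_mul_X_pow_le _ _).trans_lt (WithBot.coe_lt_coe.mpr i.2)
  have hq : q = 0 := by
    by_contra hq
    have := minpoly.degree_le_of_ne_zero M x hq hqx
    rw [hmin, degree_X_pow_sub_C hp.pos] at this
    exact absurd hdeg (not_lt.mpr this)
  have hc : q.coeff j = c j := by
    simp only [q, finsetSum_coeff, coeff_C_mul_X_pow]
    simp [Fin.val_inj]
  rw [hq] at hc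
  have := congr_arg Subtype.val hc
  simpa [c, hp.ne_zero] using this.symm

/-- Over a perfect field `K` of characteristic `p`, every element of `K(x)` is a combination of
`1, x, …, x ^ (p - 1)` with coefficients in `K(x) ^ p`. -/
theorem exists_eq_sum_pow_mul_pow {K k : Type*} [Field K] (p : ℕ) [Fact p.Prime] [CharP K p]
    [PerfectField K] [Field k] [CharP k p] [Algebra K[X] k] [IsFractionRing K[X] k] (f : k) :
    ∃ g : Fin p → k, f = ∑ j, g j ^ p * algebraMap K[X] k X ^ (j : ℕ) := by
  have hp : p.Prime := Fact.out
  have hpoly : ∀ q : K[X], ∃ g : Fin p → k,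
      algebraMap K[X] k q = ∑ j, g j ^ p * algebraMap K[X] k X ^ (j : ℕ) := by
    intro q
    induction q using Polynomial.induction_on' with
    | add q r hq hr =>
      obtain ⟨g, hg⟩ := hq
      obtain ⟨h, hh⟩ := hr
      refine ⟨g + h, ?_⟩
      rw [map_add, hg, hh, ← Finset.sum_add_distrib]
      refine Finset.sum_congr rfl fun j _ ↦ ?_
      rw [Pi.add_apply, add_pow_char, add_mul]
    | monomial n c =>
      have : PerfectRing K p := PerfectField.toPerfectRing p
      obtain ⟨d, rfl⟩ := surjective_frobenius K p c
      refine ⟨fun j ↦ if (j : ℕ) = n % p then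
        algebraMap K[X] k (C d) * algebraMap K[X] k X ^ (n / p) else 0, ?_⟩
      rw [Finset.sum_eq_single ⟨n % p, Nat.mod_lt _ hp.pos⟩]
      · beta_reduce
        rw [if_pos rfl, ← C_mul_X_pow_eq_monomial, frobenius_def, map_mul, mul_pow, ← pow_mul,
          mul_assoc, ← pow_add, mul_comm (n / p), Nat.div_add_mod, C_pow, map_pow, map_pow]
      · intro j _ hj
        beta_reduce
        rw [if_neg fun h ↦ hj (Fin.ext h), zero_pow hp.ne_zero, zero_mul]
      · simp
  obtain ⟨a, b, hb, rfl⟩ := IsFractionRing.div_surjective K[X] f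
  -- Since `a / b = a b ^ (p - 1) / b ^ p`, the denominator becomes a `p`-th power.
  obtain ⟨g, hg⟩ := hpoly (a * b ^ (p - 1))
  have hb0 : algebraMap K[X] k b ≠ 0 := by
    simpa using nonZeroDivisors.ne_zero hb
  refine ⟨fun j ↦ g j / algebraMap K[X] k b, ?_⟩
  have : algebraMap K[X] k a / algebraMap K[X] k b =
      algebraMap K[X] k (a * b ^ (p - 1)) / algebraMap K[X] k b ^ p := by
    rw [div_eq_div_iff hb0 (pow_ne_zero _ hb0), map_mul, map_pow, mul_assoc, ← pow_succ,
      Nat.sub_add_cancel hp.one_le]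
  rw [this, hg, Finset.sum_div]
  refine Finset.sum_congr rfl fun j _ ↦ ?_
  rw [div_pow]
  ring

/-- A finitely generated extension `E` of a perfect field `K` is formally smooth over `K[x]`, if `x` is
transcendental and not a `p`-th power in `E`. -/
theorem formallySmooth_polynomial_of_not_pow {K E : Type*} [Field K] [PerfectField K] [Field E]
    [Algebra K E] [Algebra K[X] E] [IsScalarTower K K[X] E] [Algebra.EssFiniteType K E]
    (hinj : Function.Injective (algebraMap K[X] E))
    (hpow : ∀ p : ℕ, p.Prime → CharP K p → ∀ y : E, y ^ p ≠ algebraMap K[X] E X) :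
    Algebra.FormallySmooth K[X] E := by
  let k := FractionRing K[X]
  have : FaithfulSMul K[X] E := (faithfulSMul_iff_algebraMap_injective _ _).mpr hinj
  let : Algebra k E := FractionRing.liftAlgebra K[X] E
  have : IsScalarTower K k E := .to₁₃₄ K K[X] k E
  have : Algebra.EssFiniteType k E := .of_comp K k E
  have : Algebra.FormallySmooth K[X] k := .of_isLocalization (nonZeroDivisors K[X])
  suffices Algebra.FormallySmooth k E from .comp K[X] k E
  obtain _ | ⟨p, hp, hpK⟩ := CharP.exists' K
  · have : CharZero k := charZero_of_injective_algebraMap (algebraMap K k).injective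
    infer_instance
  have : CharP k p := charP_of_injective_algebraMap (algebraMap K k).injective p
  have : CharP E p := charP_of_injective_algebraMap (algebraMap K E).injective p
  have : ExpChar k p := .prime hp.out
  have hp0 : p ≠ 0 := hp.out.ne_zero
  -- MacLane's criterion: `p`-th powers of `k`-independent elements must stay independent. Writing
  -- the coefficients as `∑ g ^ p x ^ j` regroups a relation into `∑ j, (∑ e, g e) ^ p x ^ j = 0`,
  -- whose inner sums vanish.
  obtain ⟨s, hs, hsep⟩ :=
    exists_isTranscendenceBasis_and_isSeparable_of_linearIndepOn_pow_of_essFiniteType (k := k) (K := E)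
      p hp.out (fun s hs ↦ by
      rw [linearIndepOn_finset_iff] at hs ⊢
      intro f hf
      choose g hg using fun e ↦ exists_eq_sum_pow_mul_pow (K := K) p (f e)
      have hx (j : ℕ) : algebraMap k E (algebraMap K[X] k X) ^ j = algebraMap K[X] E X ^ j := by
        rw [← IsScalarTower.algebraMap_apply]
      have hsum : ∑ j : Fin p, (∑ e ∈ s, algebraMap k E (g e j) * e) ^ p *
          algebraMap K[X] E X ^ (j : ℕ) = 0 := by
        rw [← hf]
        simp_rw [sum_pow_char, Finset.sum_mul]
        rw [Finset.sum_comm]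
        refine Finset.sum_congr rfl fun e _ ↦ ?_
        conv_rhs => rw [hg e]
        rw [Algebra.smul_def, map_sum, Finset.sum_mul]
        refine Finset.sum_congr rfl fun j _ ↦ ?_
        rw [map_mul, map_pow, map_pow, hx]
        ring
      have h0 := eq_zero_of_sum_pow_mul_pow_eq_zero p (hpow p hp.out hpK) _ hsum
      intro e he
      rw [hg e]
      refine Finset.sum_eq_zero fun j _ ↦ ?_
      have := hs (fun e ↦ g e j) (by simpa [Algebra.smul_def] using h0 j) e he
      rw [this, zero_pow hp0, zero_mul])
  have : Algebra.IsSeparable (IntermediateField.adjoin k (Set.range ((↑) : s → E))) E := by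
    convert! hsep <;> simp
  exact .of_algebraicIndependent_of_isSeparable hs.1

/-- In a finitely generated field extension, a transcendental element has only finitely many
iterated `p`-th roots. -/
theorem exists_pow_eq_and_forall_pow_ne {K E : Type*} [Field K] [Field E] [Algebra K E]
    [Algebra.EssFiniteType K E] (p : ℕ) [hp : Fact p.Prime] {x : E} (hx : Transcendental K x) :
    ∃ (n : ℕ) (z : E), z ^ p ^ n = x ∧ ∀ y, y ^ p ≠ z := by
  -- With `x` in a transcendence basis and the other members absorbed into `k`, the field `E` is
  -- finite over `k(x)`. Each extraction of a root strictly lowers `[E : k(z)]`, as `k(y ^ p) =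
  -- k(y)` would make `y` algebraic over `k`.
  obtain ⟨t, hxt, ht⟩ := exists_isTranscendenceBasis_superset (R := K) (s := {x})
    (by simpa [AlgebraicIndepOn] using hx)
  let k := IntermediateField.adjoin K (t \ {x})
  have hxk : Transcendental k x := by
    rw [IntermediateField.transcendental_adjoin_iff]
    have := ht.1.transcendental_adjoin (s := {i | i.1 ≠ x}) (i := ⟨x, hxt rfl⟩) (by simp)
    have himg : ((↑) : t → E) '' {i | i.1 ≠ x} = t \ {x} := by
      ext y
      simp [and_comm]
    rwa [himg] at this
  have : FiniteDimensional (IntermediateField.adjoin k {x}) E := by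
    have : Algebra.EssFiniteType k E := .of_comp K k E
    apply +allowSynthFailures Algebra.finite_of_essFiniteType_of_isAlgebraic
    · exact .of_comp k _ _
    · have h1 := ht.isAlgebraic_field
      have h2 : (IntermediateField.adjoin k {x}).restrictScalars K =
          IntermediateField.adjoin K (Set.range ((↑) : t → E)) := by
        rw [IntermediateField.adjoin_adjoin_left, Subtype.range_coe, Set.sdiff_union_of_subset hxt]
      rw [← h2] at h1
      exact h1
  have hfin : ∀ z : E, ∀ n : ℕ, z ^ p ^ n = x →
      FiniteDimensional (IntermediateField.adjoin k {z}) E := by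
    rintro z n rfl
    have hle : IntermediateField.adjoin k {z ^ p ^ n} ≤ IntermediateField.adjoin k {z} :=
      IntermediateField.adjoin_simple_le_iff.mpr
        (pow_mem (IntermediateField.mem_adjoin_simple_self k z) _)
    let := (IntermediateField.inclusion hle).toAlgebra
    have : IsScalarTower (IntermediateField.adjoin k {z ^ p ^ n})
      (IntermediateField.adjoin k {z}) E := .of_algebraMap_eq' rfl
    exact Module.Finite.of_restrictScalars_finite (IntermediateField.adjoin k {z ^ p ^ n}) _ _
  by_contra! h
  have hchain : ∀ n : ℕ, ∃ z : E, z ^ p ^ n = x ∧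
      Module.finrank (IntermediateField.adjoin k {z}) E + n ≤
        Module.finrank (IntermediateField.adjoin k {x}) E := by
    intro n
    induction n with
    | zero => exact ⟨x, by simp, by simp⟩
    | succ n ih =>
      obtain ⟨z, hz, hle⟩ := ih
      obtain ⟨y, rfl⟩ := h n z hz
      have hy : y ^ p ^ (n + 1) = x := by rw [← hz, ← pow_mul, pow_succ']
      refine ⟨y, hy, ?_⟩
      have := hfin _ _ hz
      have hlt : IntermediateField.adjoin k {y ^ p} < IntermediateField.adjoin k {y} := by
        refine lt_of_le_of_ne (IntermediateField.adjoin_simple_le_iff.mpr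
          (pow_mem (IntermediateField.mem_adjoin_simple_self k y) _)) fun heq ↦ hxk ?_
        rw [← hy]
        refine (Field.isAlgebraic_of_adjoin_eq_adjoin k E hp.out.ne_one (α := y) ?_).pow _
        rw [heq, pow_one]
      have := IntermediateField.finrank_lt_of_gt hlt
      omega
  obtain ⟨z, hz, hle⟩ := hchain (Module.finrank (IntermediateField.adjoin k {x}) E)
  have := hfin _ _ hz
  have : 0 < Module.finrank (IntermediateField.adjoin k {z}) E := Module.finrank_pos
  omega

/-- Treats all characteristics alike: `m = 1` with the identity in characteristic zero, otherwise `m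
= p ^ n` with an iterated Frobenius, surjective because `K` is perfect. -/
theorem exists_pow_eq_and_forall_prime_pow_ne {K E : Type*} [Field K] [PerfectField K] [Field E]
    [Algebra K E] [Algebra.EssFiniteType K E] {x : E} (hx : Transcendental K x) :
    ∃ (m : ℕ) (φ : K →+* K) (z : E), Function.Surjective φ ∧ (∀ y, φ y = y ^ m) ∧ z ^ m = x ∧
      ∀ p : ℕ, p.Prime → CharP K p → ∀ y : E, y ^ p ≠ z := by
  obtain _ | ⟨p, hp, hpK⟩ := CharP.exists' K
  · exact ⟨1, RingHom.id K, x, Function.surjective_id, by simp, pow_one x, fun p hp hpK ↦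
      absurd (CharP.eq K hpK (CharP.ofCharZero K)) hp.ne_zero⟩
  · obtain ⟨n, z, hz, hpow⟩ := exists_pow_eq_and_forall_pow_ne p hx
    have : PerfectRing K p := PerfectField.toPerfectRing p
    refine ⟨p ^ n, iterateFrobenius K p n, z, (bijective_iterateFrobenius K p n).surjective,
      fun y ↦ iterateFrobenius_def .., hz, fun q hq hqK ↦ ?_⟩
    obtain rfl := CharP.eq K hqK hpK
    exact hpow

/-! ### Functions with values in a subfield -/

/-- Formal smoothness of `E` is smoothness at the generic point `⊥`, which spreads to an open set;
density of rational points provides one there with `f` nonzero. -/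
theorem IsAmpleField.eq_top_of_fractionRing {K D E : Type u} [Field K] [PerfectField K]
    (hK : IsAmpleField K) [CommRing D] [IsDomain D] [Algebra K D] [Algebra K[X] D]
    [IsScalarTower K K[X] D] [Algebra.FiniteType K D] [Field E] [Algebra D E] [IsFractionRing D E]
    (hinj : Function.Injective (algebraMap K[X] D))
    (hpow : ∀ p : ℕ, p.Prime → CharP K p → ∀ y : E, y ^ p ≠ algebraMap D E (algebraMap K[X] D X))
    (hpt : ∀ h : D, h ≠ 0 → ∃ Q : D →ₐ[K] K, Q h ≠ 0) (f : D) (hf : f ≠ 0) (F : Subfield K)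
    (hF : ∀ Q : D →ₐ[K] K, Q f ≠ 0 → Q (algebraMap K[X] D X) ∈ F) : F = ⊤ := by
  let : Algebra K E := ((algebraMap D E).comp (algebraMap K D)).toAlgebra
  let : Algebra K[X] E := ((algebraMap D E).comp (algebraMap K[X] D)).toAlgebra
  have : IsScalarTower K D E := .of_algebraMap_eq' rfl
  have : IsScalarTower K[X] D E := .of_algebraMap_eq' rfl
  have : IsScalarTower K K[X] E := .to₁₂₄ K K[X] D E
  have : Algebra.EssFiniteType D E := .of_isLocalization E (nonZeroDivisors D)
  have : Algebra.EssFiniteType K E := .comp K D E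
  have : Algebra.FiniteType K[X] D := .of_restrictScalars_finiteType K K[X] D
  have : Algebra.FinitePresentation K[X] D := Algebra.FinitePresentation.of_finiteType.mp this
  have hE : Algebra.FormallySmooth K[X] E :=
    formallySmooth_polynomial_of_not_pow ((IsFractionRing.injective D E).comp hinj) hpow
  have hbot : (⊥ : Ideal D).primeCompl = nonZeroDivisors D := by
    ext a
    simp [Ideal.primeCompl]
  have : IsLocalization (⊥ : Ideal D).primeCompl E := hbot ▸ ‹IsFractionRing D E›
  have : Algebra.IsSmoothAt K[X] (⊥ : Ideal D) := Algebra.FormallySmooth.of_equiv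
    ((IsLocalization.algEquiv (⊥ : Ideal D).primeCompl E
      (Localization.AtPrime (⊥ : Ideal D))).restrictScalars K[X])
  obtain ⟨g, hg, hsm⟩ := Algebra.IsSmoothAt.exists_notMem_smooth K[X] (⊥ : Ideal D)
  let D₁ := Localization.Away g
  let D₂ := Localization.Away (algebraMap D D₁ f)
  have : Algebra.Smooth D₁ D₂ := Algebra.Smooth.of_isLocalization_Away (algebraMap D D₁ f)
  have : Algebra.Smooth K[X] D₂ := .comp K[X] D₁ D₂
  obtain ⟨Q, hQ⟩ := hpt (f * g) (mul_ne_zero hf hg)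
  rw [map_mul, mul_ne_zero_iff] at hQ
  let Q₁ : D₁ →ₐ[K] K := IsLocalization.liftAlgHom (M := Submonoid.powers g) (f := Q) (by
    rintro ⟨_, m, rfl⟩
    rw [map_pow]
    exact (IsUnit.mk0 _ hQ.2).pow m)
  have hQ₁ : Q₁ (algebraMap D D₁ f) = Q f := IsLocalization.lift_eq _ _
  let Q₂ : D₂ →ₐ[K] K := IsLocalization.liftAlgHom (M := Submonoid.powers (algebraMap D D₁ f))
    (f := Q₁) (by
    rintro ⟨_, m, rfl⟩
    rw [map_pow, hQ₁]
    exact (IsUnit.mk0 _ hQ.1).pow m)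
  refine hK.eq_top_of_smooth Q₂ F fun R ↦ ?_
  have h := hF ((R.comp (IsScalarTower.toAlgHom K D₁ D₂)).comp (IsScalarTower.toAlgHom K D D₁))
    ((IsLocalization.Away.algebraMap_isUnit (S := D₂) (algebraMap D D₁ f)).map R).ne_zero
  have hX : algebraMap D₁ D₂ (algebraMap D D₁ (algebraMap K[X] D X)) = algebraMap K[X] D₂ X := by
    rw [← IsScalarTower.algebraMap_apply K[X] D D₁, ← IsScalarTower.algebraMap_apply K[X] D₁ D₂]
  simpa [hX] using h

/-- On a variety with densely many rational points, the values of a function on an open subset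
do not all lie in a proper subfield, unless they are finite in number on some open subset. -/
theorem IsAmpleField.eq_top_of_values_mem {K D : Type u} [Field K] [PerfectField K]
    (hK : IsAmpleField K) [CommRing D] [IsDomain D] [Algebra K D] [Algebra.FiniteType K D]
    (x f : D) (hf : f ≠ 0)
    (hpt : ∀ h : D, h ≠ 0 → {y : K | ∃ Q : D →ₐ[K] K, Q h ≠ 0 ∧ Q x = y}.Infinite)
    (F : Subfield K) (hF : ∀ Q : D →ₐ[K] K, Q f ≠ 0 → Q x ∈ F) : F = ⊤ := by
  let E := FractionRing D
  have hx : Transcendental K (algebraMap D E x) := by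
    rw [transcendental_algebraMap_iff (IsFractionRing.injective D E)]
    rintro ⟨p, hp0, hp⟩
    -- An algebraic relation for `x` would confine its values to the roots of one polynomial.
    refine hpt 1 one_ne_zero (p.rootSet_finite K |>.subset ?_)
    rintro _ ⟨Q, -, rfl⟩
    rw [mem_rootSet]
    exact ⟨hp0, by rw [aeval_algHom_apply, hp, map_zero]⟩
  have : Algebra.EssFiniteType D E := .of_isLocalization E (nonZeroDivisors D)
  have : Algebra.EssFiniteType K E := .comp K D E
  obtain ⟨m, φ, z, hφ, hφm, hzm, hpow⟩ := exists_pow_eq_and_forall_prime_pow_ne hx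
  obtain ⟨a, b, hb, hz⟩ := IsFractionRing.div_surjective D z
  have hb0 : b ≠ 0 := nonZeroDivisors.ne_zero hb
  let D₁ := Localization.Away b
  have hle : Submonoid.powers b ≤ nonZeroDivisors D := powers_le_nonZeroDivisors_of_noZeroDivisors hb0
  have : IsDomain D₁ := IsLocalization.isDomain_localization hle
  let ι : D₁ →ₐ[D] E := IsLocalization.liftAlgHom (M := Submonoid.powers b)
    (f := Algebra.ofId D E) (fun y ↦ IsLocalization.map_units E (⟨y, hle y.2⟩ : nonZeroDivisors D))
  let : Algebra D₁ E := ι.toRingHom.toAlgebra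
  have : IsScalarTower D D₁ E := .of_algebraMap_eq' ι.comp_algebraMap.symm
  have : IsFractionRing D₁ E :=
    IsFractionRing.isFractionRing_of_isDomain_of_isLocalization (Submonoid.powers b) D₁ E
  have : IsScalarTower K D₁ E := .to₁₃₄ K D D₁ E
  let z₁ : D₁ := IsLocalization.mk' D₁ a ⟨b, Submonoid.mem_powers b⟩
  have hz₁ : algebraMap D₁ E z₁ = z := by
    rw [← hz, eq_div_iff (by simpa using hb0), IsScalarTower.algebraMap_apply D D₁ E b,
      IsScalarTower.algebraMap_apply D D₁ E a, ← map_mul]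
    congr 1
    exact IsLocalization.mk'_spec D₁ a ⟨b, Submonoid.mem_powers b⟩
  have hz₁m : z₁ ^ m = algebraMap D D₁ x := by
    apply IsFractionRing.injective D₁ E
    rw [map_pow, hz₁, hzm, ← IsScalarTower.algebraMap_apply]
  let : Algebra K[X] D₁ := (aeval z₁ : K[X] →ₐ[K] D₁).toRingHom.toAlgebra
  have hX : algebraMap K[X] D₁ X = z₁ := aeval_X z₁
  have : IsScalarTower K K[X] D₁ := .of_algebraMap_eq' (aeval z₁ : K[X] →ₐ[K] D₁).comp_algebraMap.symm
  have : Algebra.FinitePresentation D D₁ := IsLocalization.Away.finitePresentation b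
  have : Algebra.FiniteType K D₁ := .trans (S := D) inferInstance inferInstance
  -- From `z₁ ^ m = x`, the condition `Q x ∈ F` reads `φ (Q z₁) ∈ F`.
  have htop : F.comap φ = ⊤ := by
    refine hK.eq_top_of_fractionRing (D := D₁) (E := E) ?_ ?_ ?_ (algebraMap D D₁ f) ?_ _ ?_
    · have h1 : Transcendental K z := by
        rintro hzalg
        exact hx (hzm ▸ hzalg.pow m)
      have h2 : Transcendental K z₁ := by
        rwa [← transcendental_algebraMap_iff (IsFractionRing.injective D₁ E), hz₁]
      exact transcendental_iff_injective.mp h2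
    · rw [hX, hz₁]
      exact hpow
    · intro h hh
      obtain ⟨⟨c, s⟩, hcs⟩ := IsLocalization.surj (Submonoid.powers b) h
      have hc : c ≠ 0 := by
        rintro rfl
        rw [map_zero] at hcs
        exact hh ((IsLocalization.map_units D₁ s).mul_left_eq_zero.mp hcs)
      obtain ⟨_, Q, hQ, -⟩ := (hpt (b * c) (mul_ne_zero hb0 hc)).nonempty
      rw [map_mul, mul_ne_zero_iff] at hQ
      let Q₁ : D₁ →ₐ[K] K := IsLocalization.liftAlgHom (M := Submonoid.powers b) (f := Q) (by
        rintro ⟨_, m, rfl⟩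
        rw [map_pow]
        exact (IsUnit.mk0 _ hQ.1).pow m)
      refine ⟨Q₁, fun h0 ↦ hQ.2 ?_⟩
      have h1 : Q₁ (algebraMap D D₁ c) = Q c := IsLocalization.lift_eq _ _
      rw [← h1, ← hcs, map_mul, h0, zero_mul]
    · rw [Ne, IsLocalization.to_map_eq_zero_iff D₁ hle]
      exact hf
    · intro Q hQ
      rw [Subfield.mem_comap, hφm, hX, ← map_pow, hz₁m]
      exact hF (Q.comp (IsScalarTower.toAlgHom K D D₁)) hQ
  rw [eq_top_iff]
  intro y _
  obtain ⟨y, rfl⟩ := hφ y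
  have : y ∈ F.comap φ := htop ▸ Subfield.mem_top y
  exact this

/-! ### Quantifier-free and existential formulas over a field -/

section
open FirstOrder FirstOrder.Language

theorem exists_mvPolynomial_realize {K : Type*} [Field K] [FirstOrder.Ring.CompatibleRing K] (A : Set K)
    {β : Type*} (t : (Language.ring[[A]]).Term β) :
    ∃ p : MvPolynomial β K, ∀ w : β → K, t.realize w = MvPolynomial.eval w p := by
  induction t with
  | var i => exact ⟨.X i, fun w ↦ by simp⟩
  | @func n f ts ih =>
    choose p hp using ih
    cases f with
    | inl f =>
      have h (w : β → K) : Term.realize w (Term.func (Sum.inl f : (Language.ring[[A]]).Functions n) ts) =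
          Structure.funMap (L := Language.ring) f fun i ↦ MvPolynomial.eval w (p i) := by
        simp only [← hp]
        rfl
      simp only [h]
      cases f with
      | add => exact ⟨p 0 + p 1, fun w ↦ by rw [map_add]; exact Ring.CompatibleRing.funMap_add _⟩
      | mul => exact ⟨p 0 * p 1, fun w ↦ by rw [map_mul]; exact Ring.CompatibleRing.funMap_mul _⟩
      | neg => exact ⟨-p 0, fun w ↦ by rw [map_neg]; exact Ring.CompatibleRing.funMap_neg _⟩
      | zero => exact ⟨0, fun w ↦ by rw [map_zero]; exact Ring.CompatibleRing.funMap_zero _⟩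
      | one => exact ⟨1, fun w ↦ by rw [map_one]; exact Ring.CompatibleRing.funMap_one _⟩
    | inr c =>
      cases n with
      | zero => exact ⟨.C (c : A).1, fun w ↦ by rw [MvPolynomial.eval_C]; rfl⟩
      | succ n => exact isEmptyElim c

/-- A quantifier-free formula is constant on a nonempty open subset of an irreducible closed set. -/
theorem FirstOrder.Language.BoundedFormula.IsQF.exists_generically_constant {K : Type*} [Field K]
    [FirstOrder.Ring.CompatibleRing K] {A : Set K} {α : Type*} {n : ℕ}
    {φ : (Language.ring[[A]]).BoundedFormula α n} (hφ : φ.IsQF)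
    (I : Ideal (MvPolynomial (α ⊕ Fin n) K)) [hI : I.IsPrime] :
    ∃ f ∉ I, (∀ w : α ⊕ Fin n → K, (∀ p ∈ I, MvPolynomial.eval w p = 0) →
        MvPolynomial.eval w f ≠ 0 → φ.Realize (w ∘ Sum.inl) (w ∘ Sum.inr)) ∨
      (∀ w : α ⊕ Fin n → K, (∀ p ∈ I, MvPolynomial.eval w p = 0) →
        MvPolynomial.eval w f ≠ 0 → ¬ φ.Realize (w ∘ Sum.inl) (w ∘ Sum.inr)) := by
  induction hφ with
  | falsum => exact ⟨1, (Ideal.ne_top_iff_one I).mp hI.ne_top, .inr fun w _ _ h ↦ h⟩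
  | of_isAtomic h =>
    cases h with
    | equal t₁ t₂ =>
      obtain ⟨p, hp⟩ := exists_mvPolynomial_realize A t₁
      obtain ⟨q, hq⟩ := exists_mvPolynomial_realize A t₂
      have hr (w : α ⊕ Fin n → K) : (t₁.bdEqual t₂).Realize (w ∘ Sum.inl) (w ∘ Sum.inr) ↔
          MvPolynomial.eval w (p - q) = 0 := by
        rw [BoundedFormula.realize_bdEqual, Sum.elim_comp_inl_inr, hp, hq, map_sub, sub_eq_zero]
      by_cases hpq : p - q ∈ I
      · exact ⟨1, (Ideal.ne_top_iff_one I).mp hI.ne_top, .inl fun w hw _ ↦ (hr w).mpr (hw _ hpq)⟩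
      · exact ⟨p - q, hpq, .inr fun w _ hw h ↦ hw ((hr w).mp h)⟩
    | rel R ts =>
      cases R with
      | inl R => exact isEmptyElim R
      | inr R => exact isEmptyElim R
  | imp _ _ h₁ h₂ =>
    obtain ⟨f, hf, h₁⟩ := h₁
    obtain ⟨g, hg, h₂⟩ := h₂
    refine ⟨f * g, hI.mul_notMem hf hg, ?_⟩
    simp only [map_mul, mul_ne_zero_iff, BoundedFormula.realize_imp]
    rcases h₁ with h₁ | h₁
    · rcases h₂ with h₂ | h₂
      · exact .inl fun w hw hfg _ ↦ h₂ w hw hfg.2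
      · exact .inr fun w hw hfg h ↦ h₂ w hw hfg.2 (h (h₁ w hw hfg.1))
    · exact .inl fun w hw hfg h ↦ absurd h (h₁ w hw hfg.1)

/-- The existential witnesses are appended to the bound variables, so `ys` extends `xs` through
`Fin.castLE`. -/
theorem FirstOrder.Language.BoundedFormula.IsExistential.exists_isQF {L : Language} {M : Type*}
    [L.Structure M] {α : Type*} {n : ℕ} {φ : L.BoundedFormula α n} (hφ : φ.IsExistential) :
    ∃ (m : ℕ) (h : n ≤ m) (ψ : L.BoundedFormula α m), ψ.IsQF ∧ ∀ (v : α → M) (xs : Fin n → M),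
      φ.Realize v xs ↔ ∃ ys : Fin m → M, ys ∘ Fin.castLE h = xs ∧ ψ.Realize v ys := by
  induction hφ with
  | of_isQF h => exact ⟨_, le_rfl, _, h, fun v xs ↦ by simp⟩
  | @ex n φ _ ih =>
    obtain ⟨m, h, ψ, hψ, hr⟩ := ih
    refine ⟨m, (Nat.le_succ n).trans h, ψ, hψ, fun v xs ↦ ?_⟩
    rw [BoundedFormula.realize_ex]
    constructor
    · rintro ⟨a, ha⟩
      obtain ⟨ys, hys, hψ⟩ := (hr _ _).mp ha
      refine ⟨ys, ?_, hψ⟩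
      ext i
      have := congr_fun hys i.castSucc
      simpa using this
    · rintro ⟨ys, rfl, hψ⟩
      refine ⟨ys (Fin.castLE h (Fin.last n)), (hr _ _).mpr ⟨ys, ?_, hψ⟩⟩
      ext i
      refine Fin.lastCases ?_ (fun i ↦ ?_) i <;> simp

end

/-! ### Irreducible sets with infinitely many coordinate values, and the conclusion -/

/-- Among the closed sets on which a coordinate takes infinitely many values in points of
`S`, a minimal one is irreducible. -/
theorem exists_prime_infinite_coordinate {K σ : Type*} [Field K] [Finite σ] (S : Set (σ → K)) (i : σ)
    (hS : ((fun w ↦ w i) '' S).Infinite) :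
    ∃ I : Ideal (MvPolynomial σ K), I.IsPrime ∧ ∀ f ∉ I, ((fun w ↦ w i) '' {w | w ∈ S ∧
      (∀ p ∈ I, MvPolynomial.eval w p = 0) ∧ MvPolynomial.eval w f ≠ 0}).Infinite := by
  let Z (I : Ideal (MvPolynomial σ K)) : Set (σ → K) := {w | w ∈ S ∧ ∀ p ∈ I, MvPolynomial.eval w p = 0}
  obtain ⟨I, hI, hmax⟩ := set_has_maximal_iff_noetherian.mpr
    (inferInstance : IsNoetherianRing (MvPolynomial σ K)) {I | ((fun w ↦ w i) '' Z I).Infinite}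
    ⟨⊥, by simpa [Z] using hS⟩
  have hfin : ∀ f ∉ I, ((fun w ↦ w i) '' {w | w ∈ Z I ∧ MvPolynomial.eval w f = 0}).Finite := by
    intro f hf
    -- By maximality, adding any `f ∉ I` leaves only finitely many values.
    have hlt : I < I ⊔ Ideal.span {f} := by
      rw [left_lt_sup, Ideal.span_singleton_le_iff_mem]
      exact hf
    have := fun h ↦ hmax _ h hlt
    refine (Set.not_infinite.mp this).subset (Set.image_mono ?_)
    rintro w ⟨⟨hwS, hwI⟩, hwf⟩
    refine ⟨hwS, fun p hp ↦ ?_⟩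
    have hle : I ⊔ Ideal.span {f} ≤ RingHom.ker (MvPolynomial.eval w) :=
      sup_le hwI ((Ideal.span_singleton_le_iff_mem _).mpr hwf)
    exact hle hp
  have hinf : ∀ f ∉ I, ((fun w ↦ w i) '' {w | w ∈ Z I ∧ MvPolynomial.eval w f ≠ 0}).Infinite := by
    intro f hf h
    refine hI (((hfin f hf).union h).subset ?_)
    rw [← Set.image_union]
    refine Set.image_mono fun w hw ↦ ?_
    by_cases h0 : MvPolynomial.eval w f = 0
    · exact .inl ⟨hw, h0⟩
    · exact .inr ⟨hw, h0⟩
  refine ⟨I, ⟨?_, fun {a b} hab ↦ ?_⟩, fun f hf ↦ (hinf f hf).mono (Set.image_mono fun w hw ↦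
    ⟨hw.1.1, hw.1.2, hw.2⟩)⟩
  · rintro rfl
    obtain ⟨_, w, ⟨-, hw⟩, -⟩ := Set.Infinite.nonempty hI
    simpa using hw 1 Submodule.mem_top
  · by_contra! h
    -- Where `a ≠ 0`, the product relation forces `b = 0`, so infinitely many values would lie in a
    -- finite set.
    refine hinf a h.1 ((hfin b h.2).subset (Set.image_mono ?_))
    rintro w ⟨hw, hwa⟩
    refine ⟨hw, ?_⟩
    have := hw.2 _ hab
    rw [map_mul] at this
    exact (mul_eq_zero.mp this).resolve_left hwa

theorem IsAmpleField.eq_top_of_infinite_subset {K : Type u} [Field K] [PerfectField K]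
    (hK : IsAmpleField K) {σ : Type} [Finite σ] (S : Set (σ → K)) (i : σ)
    (hinf : ((fun w ↦ w i) '' S).Infinite)
    (hS : ∀ I : Ideal (MvPolynomial σ K), I.IsPrime → ∃ f ∉ I,
      (∀ w : σ → K, (∀ p ∈ I, MvPolynomial.eval w p = 0) → MvPolynomial.eval w f ≠ 0 → w ∈ S) ∨
      (∀ w : σ → K, (∀ p ∈ I, MvPolynomial.eval w p = 0) → MvPolynomial.eval w f ≠ 0 → w ∉ S))
    (F : Subfield K) (hF : ∀ w ∈ S, w i ∈ F) : F = ⊤ := by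
  obtain ⟨I, hI, hIinf⟩ := exists_prime_infinite_coordinate S i hinf
  obtain ⟨f, hf, hfS⟩ := hS I hI
  have hfS : ∀ w : σ → K, (∀ p ∈ I, MvPolynomial.eval w p = 0) → MvPolynomial.eval w f ≠ 0 →
      w ∈ S := by
    -- Points of `S` meet every nonempty open part of the zero set of `I`, so the formula cannot be
    -- generically false.
    refine hfS.resolve_right fun h ↦ ?_
    obtain ⟨_, w, ⟨hwS, hwI, hwf⟩, -⟩ := (hIinf f hf).nonempty
    exact h w hwI hwf hwS
  let mk := Ideal.Quotient.mkₐ K I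
  have hQ (Q : (MvPolynomial σ K ⧸ I) →ₐ[K] K) (p : MvPolynomial σ K) :
      Q (mk p) = MvPolynomial.eval (fun j ↦ Q (mk (.X j))) p := by
    have : Q.comp mk = MvPolynomial.aeval fun j ↦ Q (mk (.X j)) := by
      ext j
      simp
    rw [← MvPolynomial.aeval_eq_eval]
    exact congr($this p)
  have hmk : ∀ p, mk p = 0 ↔ p ∈ I := fun p ↦ Ideal.Quotient.eq_zero_iff_mem
  refine hK.eq_top_of_values_mem (mk (.X i)) (mk f) ((hmk f).not.mpr hf) (fun h hh ↦ ?_) F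
    (fun Q hQf ↦ ?_)
  · obtain ⟨h, rfl⟩ := Ideal.Quotient.mkₐ_surjective K I h
    refine (hIinf h ((hmk h).not.mp hh)).mono ?_
    rintro _ ⟨w, ⟨-, hwI, hwh⟩, rfl⟩
    let Q : (MvPolynomial σ K ⧸ I) →ₐ[K] K := Ideal.Quotient.liftₐ I (MvPolynomial.aeval w)
      (fun p hp ↦ by simpa using hwI p hp)
    have hQw : ∀ p, Q (mk p) = MvPolynomial.eval w p := fun p ↦ by
      rw [← MvPolynomial.aeval_eq_eval]
      exact Ideal.Quotient.liftₐ_apply I _ _ _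
    exact ⟨Q, by rw [hQw]; exact hwh, by rw [hQw]; simp⟩
  · rw [hQ] at hQf
    refine hF _ (hfS _ (fun p hp ↦ ?_) hQf)
    rw [← hQ, (hmk p).mpr hp, map_zero]

theorem mainTheorem6 (K : Type u) [Field K] [FirstOrder.Ring.CompatibleRing K] [PerfectField K]
    (hK : IsAmpleField K) :
    ¬ ∃ F : Subfield K, F ≠ ⊤ ∧ Infinite F ∧
      ExistentiallyDefinable₁ FirstOrder.Language.ring (Set.univ : Set K) (F : Set K) := by
  rintro ⟨F, hne, hinf, φ, hφ, hFφ⟩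
  obtain ⟨m, h, ψ, hψ, hr⟩ :=
    FirstOrder.Language.BoundedFormula.IsExistential.exists_isQF (M := K) hφ
  let S : Set (Fin 1 ⊕ Fin m → K) := {w | ψ.Realize (w ∘ Sum.inl) (w ∘ Sum.inr)}
  have hS : (fun w ↦ w (Sum.inl 0)) '' S = F := by
    rw [hFφ]
    ext x
    change _ ↔ φ.Realize fun _ ↦ x
    rw [FirstOrder.Language.Formula.Realize, hr]
    constructor
    · rintro ⟨w, hw, rfl⟩
      -- A formula starts with no bound variables, so the compatibility of `ys` with `xs` is an
      -- equality of functions on `Fin 0`.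
      refine ⟨w ∘ Sum.inr, Subsingleton.elim _ _, ?_⟩
      have : w ∘ Sum.inl = fun _ ↦ w (Sum.inl 0) := by
        ext i
        rw [Subsingleton.elim i 0]
        rfl
      rw [← this]
      exact hw
    · rintro ⟨ys, -, hys⟩
      exact ⟨Sum.elim (fun _ ↦ x) ys, hys, rfl⟩
  refine hne (hK.eq_top_of_infinite_subset S (Sum.inl 0) ?_ (fun I hI ↦
    hψ.exists_generically_constant I) F fun w hw ↦ ?_)
  · rw [hS]
    exact Set.infinite_coe_iff.mp hinf
  · have : w (Sum.inl 0) ∈ (fun w ↦ w (Sum.inl 0)) '' S := ⟨w, hw, rfl⟩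
    rwa [hS] at this
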